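/- An $n\times n$ $0$-$1$ matrix $A$ contains a $k\times k$ permutation matrix $P$ if there are rows $r_1<\dots<r_k$ and columns $q_1<\dots<q_k$ with $A_{r_i,q_j}=1$ whenever $P_{i,j}=1$; otherwise $A$ avoids $P$. Let $S_P(n)$ be the number of $n\times n$ permutation matrices avoiding $P$, and let $\mathrm{ex}(n,P)$ be the maximum number of ones in an $n\times n$ $0$-$1$ matrix avoiding $P$. For real $c>0$ put \[ F(c)=\inf_{t\in\mathbb{Z},\,t\ge 1}\frac{(t!)^{1/t}\,15^{c/t}}{c}. \] Let $P$ be a permutation matrix. Then the limits \[ s_P=\lim_{n\to\infty}S_P(n)^{1/n},\qquad c_P=\lim_{n\to\infty}\frac{\mathrm{ex}(n,P)}{n} \] (the Stanley-Wilf limit and the Füredi-Hajnal limit of $P$) exist as finite real numbers, and if $c_P\ge 17$, then \[ s_P\le F(c_P)\,c_P^2\qquad\text{and}\qquad F(c_P)<2.88. \] -/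

import Mathlib

open Filter Topology

namespace ForbiddenPattern

/-- A square `0`-`1` matrix of size `n`. -/
abbrev ZeroOneMatrix (n : ℕ) : Type := Matrix (Fin n) (Fin n) (Fin 2)

/-- `A` is the permutation matrix of some permutation. -/
def IsPermMatrix {n : ℕ} (A : ZeroOneMatrix n) : Prop :=
  ∃ σ : Equiv.Perm (Fin n), A = σ.permMatrix (Fin 2)

/-- `A` contains `P`: there are rows `r 0 < r 1 < ⋯` and columns `c 0 < c 1 < ⋯` of `A` such that
`A (r i) (c j) = 1` whenever `P i j = 1`. -/
def Contains {n k : ℕ} (A : ZeroOneMatrix n) (P : ZeroOneMatrix k) : Prop :=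
  ∃ r c : Fin k → Fin n, StrictMono r ∧ StrictMono c ∧
    ∀ i j, P i j = 1 → A (r i) (c j) = 1

/-- `A` avoids `P`. -/
def Avoids {n k : ℕ} (A : ZeroOneMatrix n) (P : ZeroOneMatrix k) : Prop :=
  ¬ Contains A P

/-- The number of ones of a `0`-`1` matrix. -/
def numOnes {n : ℕ} (A : ZeroOneMatrix n) : ℕ :=
  (Finset.univ.filter fun p : Fin n × Fin n => A p.1 p.2 = 1).card

open Classical in
/-- The number `S_P(n)` of `n × n` permutation matrices avoiding `P`. -/
noncomputable def numAvoiders {k : ℕ} (P : ZeroOneMatrix k) (n : ℕ) : ℕ :=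
  (Finset.univ.filter fun A : ZeroOneMatrix n => IsPermMatrix A ∧ Avoids A P).card

open Classical in
/-- The extremal number `ex(n, P)`: the maximal number of ones in an `n × n` `0`-`1` matrix
avoiding `P`. -/
noncomputable def ex (n : ℕ) {k : ℕ} (P : ZeroOneMatrix k) : ℕ :=
  (Finset.univ.filter fun A : ZeroOneMatrix n => Avoids A P).sup numOnes

/-- The Stanley-Wilf limit `s_P = lim S_P(n)^(1/n)`. -/
noncomputable def stanleyWilfLimit {k : ℕ} (P : ZeroOneMatrix k) : ℝ :=
  limUnder atTop fun n : ℕ => (numAvoiders P n : ℝ) ^ (1 / (n : ℝ))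

/-- The Füredi-Hajnal limit `c_P = lim ex(n, P) / n`. -/
noncomputable def furediHajnalLimit {k : ℕ} (P : ZeroOneMatrix k) : ℝ :=
  limUnder atTop fun n : ℕ => (ex n P : ℝ) / (n : ℝ)

/-- `F(c) = inf_{t ≥ 1} (t!)^(1/t) * 15^(c/t) / c`, over the positive integers `t`. -/
noncomputable def F (c : ℝ) : ℝ :=
  ⨅ t : ℕ+, ((Nat.factorial (t : ℕ) : ℝ) ^ (1 / ((t : ℕ) : ℝ)) *
    (15 : ℝ) ^ (c / ((t : ℕ) : ℝ))) / c

end ForbiddenPattern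

namespace ForbiddenPattern

/-! Existence of the limits. A permutation matrix cannot decompose along both diagonals, so placing
two avoiders on a suitable diagonal gives an avoider (`exists_avoids_blockSum`). Hence `ex` is
superadditive and `numAvoiders` supermultiplicative, and Fekete's lemma applies once growth is
controlled: linearly for `ex` by Marcus-Tardos (`ex_mul_le`), exponentially for `numAvoiders` by the
count below. Fekete also gives ex(n, P) ≤ c n for every n.

The bound. Cut an avoiding permutation matrix of size nt into t × t blocks; the n × n pattern B of
nonzero blocks avoids P. By Klazar's doubling there are at most 2 · 15^(cn) such B when n = 2^m.
Given B, choosing a block column for each row costs at most c^(nt) by AM-GM, and ordering inside the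
block columns costs (t!)^n (`numAvoiders_mul_le_numAvoidingMatrices`). Taking nt-th roots as m → ∞
gives s ≤ (t!)^(1/t) 15^(c/t) c for every t ≥ 1, which is F(c) c² after taking the infimum.

The constant. With t near c log 15 and t! near (t/e)^t, the quantity in F is near log 15 ≈ 2.708;
`F_lt` controls the loss for c ≥ 17. -/

theorem permMatrix_eq_one_iff {n : ℕ} (σ : Equiv.Perm (Fin n)) (i j : Fin n) :
    σ.permMatrix (Fin 2) i j = 1 ↔ σ i = j := by
  simp [Equiv.Perm.permMatrix, PEquiv.toMatrix_apply, eq_comm]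

theorem contains_permMatrix_iff {n k : ℕ} {A : ZeroOneMatrix n} {π : Equiv.Perm (Fin k)} :
    Contains A (π.permMatrix (Fin 2)) ↔ ∃ r c : Fin k → Fin n, StrictMono r ∧ StrictMono c ∧
      ∀ i, A (r i) (c (π i)) = 1 := by
  simp [Contains]

theorem avoids_of_lt {n k : ℕ} (A : ZeroOneMatrix n) (P : ZeroOneMatrix k) (h : n < k) :
    Avoids A P := by
  rintro ⟨r, c, hr, -, -⟩
  have := Fintype.card_le_of_injective r hr.injective
  simp at this
  omega

theorem avoids_zero {n k : ℕ} (hk : 0 < k) (π : Equiv.Perm (Fin k)) :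
    Avoids (0 : ZeroOneMatrix n) (π.permMatrix (Fin 2)) := by
  rw [Avoids, contains_permMatrix_iff]
  rintro ⟨r, c, -, -, h⟩
  simpa using h ⟨0, hk⟩

theorem contains_of_eq_one {n k : ℕ} (hk : k ≤ 1) {A : ZeroOneMatrix n} {i j : Fin n}
    (h : A i j = 1) (P : ZeroOneMatrix k) : Contains A P := by
  have : Subsingleton (Fin k) := Fin.subsingleton_iff_le_one.2 hk
  exact ⟨fun _ => i, fun _ => j, Subsingleton.strictMono _, Subsingleton.strictMono _,
    fun _ _ _ => h⟩

theorem numOnes_eq_sum {n : ℕ} (A : ZeroOneMatrix n) :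
    numOnes A = ∑ i, ∑ j, if A i j = 1 then 1 else 0 := by
  rw [numOnes, Finset.card_filter, Fintype.sum_prod_type]

theorem numOnes_le_ex {n k : ℕ} {A : ZeroOneMatrix n} {P : ZeroOneMatrix k} (h : Avoids A P) :
    numOnes A ≤ ex n P := by
  classical
  rw [ex]
  exact Finset.le_sup (f := numOnes) (by simpa using h)

theorem exists_numOnes_eq_ex {k : ℕ} (hk : 0 < k) (π : Equiv.Perm (Fin k)) (n : ℕ) :
    ∃ A : ZeroOneMatrix n, Avoids A (π.permMatrix (Fin 2)) ∧
      numOnes A = ex n (π.permMatrix (Fin 2)) := by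
  classical
  obtain ⟨A, hA, h⟩ := Finset.exists_mem_eq_sup
    (Finset.univ.filter fun A : ZeroOneMatrix n => Avoids A (π.permMatrix (Fin 2)))
    ⟨0, by simpa using avoids_zero hk π⟩ numOnes
  refine ⟨A, by simpa using hA, ?_⟩
  rw [ex, ← h]

/-! ### Block sums, superadditivity and supermultiplicativity -/

/-- The block matrix with diagonal blocks `A` and `B`, its columns being arranged by `φ`. -/
def blockSum {m n : ℕ} (φ : Fin m ⊕ Fin n ≃ Fin (m + n)) (A : ZeroOneMatrix m)
    (B : ZeroOneMatrix n) : ZeroOneMatrix (m + n) :=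
  (Matrix.fromBlocks A 0 0 B).submatrix finSumFinEquiv.symm φ.symm

theorem blockSum_inl_inl {m n : ℕ} (φ : Fin m ⊕ Fin n ≃ Fin (m + n)) (A : ZeroOneMatrix m)
    (B : ZeroOneMatrix n) (i j) :
    blockSum φ A B (finSumFinEquiv (.inl i)) (φ (.inl j)) = A i j := by
  simp only [blockSum, Matrix.submatrix_apply, Equiv.symm_apply_apply, Matrix.fromBlocks_apply₁₁]

theorem blockSum_inl_inr {m n : ℕ} (φ : Fin m ⊕ Fin n ≃ Fin (m + n)) (A : ZeroOneMatrix m)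
    (B : ZeroOneMatrix n) (i j) :
    blockSum φ A B (finSumFinEquiv (.inl i)) (φ (.inr j)) = 0 := by
  simp only [blockSum, Matrix.submatrix_apply, Equiv.symm_apply_apply, Matrix.fromBlocks_apply₁₂,
    Matrix.zero_apply]

theorem blockSum_inr_inl {m n : ℕ} (φ : Fin m ⊕ Fin n ≃ Fin (m + n)) (A : ZeroOneMatrix m)
    (B : ZeroOneMatrix n) (i j) :
    blockSum φ A B (finSumFinEquiv (.inr i)) (φ (.inl j)) = 0 := by
  simp only [blockSum, Matrix.submatrix_apply, Equiv.symm_apply_apply, Matrix.fromBlocks_apply₂₁,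
    Matrix.zero_apply]

theorem blockSum_inr_inr {m n : ℕ} (φ : Fin m ⊕ Fin n ≃ Fin (m + n)) (A : ZeroOneMatrix m)
    (B : ZeroOneMatrix n) (i j) :
    blockSum φ A B (finSumFinEquiv (.inr i)) (φ (.inr j)) = B i j := by
  simp only [blockSum, Matrix.submatrix_apply, Equiv.symm_apply_apply, Matrix.fromBlocks_apply₂₂]

theorem numOnes_blockSum {m n : ℕ} (φ : Fin m ⊕ Fin n ≃ Fin (m + n)) (A : ZeroOneMatrix m)
    (B : ZeroOneMatrix n) : numOnes (blockSum φ A B) = numOnes A + numOnes B := by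
  simp only [numOnes_eq_sum]
  rw [← finSumFinEquiv.sum_comp, Fintype.sum_sum_type]
  congr 1 <;> refine Finset.sum_congr rfl fun i _ => ?_ <;>
    rw [← φ.sum_comp, Fintype.sum_sum_type] <;>
    simp [-finSumFinEquiv_apply_left, -finSumFinEquiv_apply_right, blockSum_inl_inl,
      blockSum_inl_inr, blockSum_inr_inl, blockSum_inr_inr]

theorem blockSum_injective {m n : ℕ} (φ : Fin m ⊕ Fin n ≃ Fin (m + n)) :
    Function.Injective fun X : ZeroOneMatrix m × ZeroOneMatrix n => blockSum φ X.1 X.2 := by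
  rintro ⟨A, B⟩ ⟨A', B'⟩ h
  refine Prod.ext ?_ ?_ <;> ext1 i j
  · have := congrFun (congrFun h (finSumFinEquiv (.inl i))) (φ (.inl j))
    simpa only [blockSum_inl_inl] using this
  · have := congrFun (congrFun h (finSumFinEquiv (.inr i))) (φ (.inr j))
    simpa only [blockSum_inr_inr] using this

theorem isPermMatrix_blockSum {m n : ℕ} (φ : Fin m ⊕ Fin n ≃ Fin (m + n)) {A : ZeroOneMatrix m}
    {B : ZeroOneMatrix n} (hA : IsPermMatrix A) (hB : IsPermMatrix B) :
    IsPermMatrix (blockSum φ A B) := by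
  obtain ⟨σ, rfl⟩ := hA
  obtain ⟨τ, rfl⟩ := hB
  refine ⟨(finSumFinEquiv.symm.trans (Equiv.sumCongr σ τ)).trans φ, ?_⟩
  ext1 i j
  obtain ⟨i, rfl⟩ := finSumFinEquiv.surjective i
  obtain ⟨j, rfl⟩ := φ.surjective j
  rcases i with i | i <;> rcases j with j | j
  · rw [blockSum_inl_inl]
    simp [-finSumFinEquiv_apply_left, Equiv.Perm.permMatrix, PEquiv.toMatrix_apply]
  · rw [blockSum_inl_inr]
    simp [-finSumFinEquiv_apply_left, Equiv.Perm.permMatrix, PEquiv.toMatrix_apply]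
  · rw [blockSum_inr_inl]
    simp [-finSumFinEquiv_apply_right, Equiv.Perm.permMatrix, PEquiv.toMatrix_apply]
  · rw [blockSum_inr_inr]
    simp [-finSumFinEquiv_apply_right, Equiv.Perm.permMatrix, PEquiv.toMatrix_apply]

/-- A copy of the pattern lying in one block is excluded. Otherwise its first row meets `A` and its
last row meets `B`, and `hφ` makes the columns used by these two rows come in the wrong order. -/
theorem avoids_blockSum {m n k : ℕ} {π : Equiv.Perm (Fin (k + 1))}
    {φ : Fin m ⊕ Fin n ≃ Fin (m + n)} (hl : StrictMono (φ ∘ Sum.inl))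
    (hr : StrictMono (φ ∘ Sum.inr))
    (hφ : (∀ i j, φ (.inl i) < φ (.inr j)) ∧ π (Fin.last k) ≤ π 0 ∨
      (∀ i j, φ (.inr j) < φ (.inl i)) ∧ π 0 < π (Fin.last k))
    {A : ZeroOneMatrix m} {B : ZeroOneMatrix n} (hA : Avoids A (π.permMatrix (Fin 2)))
    (hB : Avoids B (π.permMatrix (Fin 2))) :
    Avoids (blockSum φ A B) (π.permMatrix (Fin 2)) := by
  rw [Avoids, contains_permMatrix_iff] at *
  rintro ⟨r, c, hrm, hcm, h⟩
  have rows : ∀ i, (∃ x y, r i = finSumFinEquiv (.inl x) ∧ c (π i) = φ (.inl y) ∧ A x y = 1) ∨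
      ∃ x y, r i = finSumFinEquiv (.inr x) ∧ c (π i) = φ (.inr y) ∧ B x y = 1 := by
    intro i
    obtain ⟨x, hx⟩ := finSumFinEquiv.surjective (r i)
    obtain ⟨y, hy⟩ := φ.surjective (c (π i))
    have h1 := h i
    rw [← hx, ← hy] at h1
    rcases x with x | x <;> rcases y with y | y
    · rw [blockSum_inl_inl] at h1
      exact .inl ⟨x, y, hx.symm, hy.symm, h1⟩
    · rw [blockSum_inl_inr] at h1
      simp at h1
    · rw [blockSum_inr_inl] at h1
      simp at h1
    · rw [blockSum_inr_inr] at h1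
      exact .inr ⟨x, y, hx.symm, hy.symm, h1⟩
  have lt_rows : ∀ (x : Fin m) (y : Fin n),
      (finSumFinEquiv (.inl x) : Fin (m + n)) < finSumFinEquiv (.inr y) := by
    intro x y
    simp only [finSumFinEquiv_apply_left, finSumFinEquiv_apply_right, Fin.lt_def, Fin.val_castAdd,
      Fin.val_natAdd]
    omega
  by_cases hlast : ∃ x y, r (Fin.last k) = finSumFinEquiv (.inl x) ∧
      c (π (Fin.last k)) = φ (.inl y) ∧ A x y = 1
  · have all : ∀ i, ∃ x y, r i = finSumFinEquiv (.inl x) ∧ c (π i) = φ (.inl y) ∧ A x y = 1 := by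
      intro i
      refine (rows i).resolve_right ?_
      rintro ⟨x, y, hx, -⟩
      obtain ⟨x', y', hx', -⟩ := hlast
      have := hrm.monotone (Fin.le_last i)
      rw [hx, hx'] at this
      exact absurd this (lt_rows _ _).not_ge
    choose x y hx hy hxy using all
    refine hA ⟨x, y ∘ π.symm, fun i j hij => ?_, fun i j hij => ?_, fun i => by simpa using hxy i⟩
    · have := hrm hij
      rw [hx, hx] at this
      exact this
    · have := hcm hij
      rw [← π.apply_symm_apply i, ← π.apply_symm_apply j, hy, hy] at this
      exact hl.lt_iff_lt.1 this
  · by_cases hfirst : ∃ x y, r 0 = finSumFinEquiv (.inr x) ∧ c (π 0) = φ (.inr y) ∧ B x y = 1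
    · have all : ∀ i, ∃ x y, r i = finSumFinEquiv (.inr x) ∧ c (π i) = φ (.inr y) ∧
          B x y = 1 := by
        intro i
        refine (rows i).resolve_left ?_
        rintro ⟨x, y, hx, -⟩
        obtain ⟨x', y', hx', -⟩ := hfirst
        have := hrm.monotone (Fin.zero_le i)
        rw [hx, hx'] at this
        exact absurd this (lt_rows _ _).not_ge
      choose x y hx hy hxy using all
      refine hB ⟨x, y ∘ π.symm, fun i j hij => ?_, fun i j hij => ?_,
        fun i => by simpa using hxy i⟩
      · have := hrm hij
        rw [hx, hx] at this
        simpa using this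
      · have := hcm hij
        rw [← π.apply_symm_apply i, ← π.apply_symm_apply j, hy, hy] at this
        exact hr.lt_iff_lt.1 this
    · obtain ⟨x, y, -, hy, -⟩ := (rows 0).resolve_right hfirst
      obtain ⟨x', y', -, hy', -⟩ := (rows (Fin.last k)).resolve_left hlast
      rcases hφ with ⟨h1, h2⟩ | ⟨h1, h2⟩
      · have := hcm.monotone h2
        rw [hy, hy'] at this
        exact absurd this (h1 _ _).not_ge
      · have := hcm h2
        rw [hy, hy'] at this
        exact absurd this (h1 _ _).not_gt

/-- A permutation matrix is either sum-indecomposable or skew-indecomposable. -/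
theorem exists_avoids_blockSum {k : ℕ} (hk : 0 < k) (π : Equiv.Perm (Fin k)) (m n : ℕ) :
    ∃ φ : Fin m ⊕ Fin n ≃ Fin (m + n), ∀ (A : ZeroOneMatrix m) (B : ZeroOneMatrix n),
      Avoids A (π.permMatrix (Fin 2)) → Avoids B (π.permMatrix (Fin 2)) →
      Avoids (blockSum φ A B) (π.permMatrix (Fin 2)) := by
  obtain ⟨k, rfl⟩ := Nat.exists_eq_succ_of_ne_zero hk.ne'
  rcases le_or_gt (π (Fin.last k)) (π 0) with h | h
  · refine ⟨finSumFinEquiv, fun A B hA hB => avoids_blockSum ?_ ?_ (.inl ⟨?_, h⟩) hA hB⟩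
    · intro i j hij
      exact hij
    · intro i j hij
      simpa using hij
    · intro i j
      simp only [finSumFinEquiv_apply_left, finSumFinEquiv_apply_right, Fin.lt_def,
        Fin.val_castAdd, Fin.val_natAdd]
      omega
  · refine ⟨(Equiv.sumComm _ _).trans (finSumFinEquiv.trans (finCongr (Nat.add_comm n m))),
      fun A B hA hB => avoids_blockSum ?_ ?_ (.inr ⟨?_, h⟩) hA hB⟩
    · intro i j hij
      simpa using hij
    · intro i j hij
      rw [Fin.lt_def] at hij ⊢
      simpa using hij
    · intro i j
      simp [Fin.lt_def]
      omega

theorem ex_add_le {k : ℕ} (hk : 0 < k) (π : Equiv.Perm (Fin k)) (m n : ℕ) :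
    ex m (π.permMatrix (Fin 2)) + ex n (π.permMatrix (Fin 2)) ≤
      ex (m + n) (π.permMatrix (Fin 2)) := by
  obtain ⟨φ, hφ⟩ := exists_avoids_blockSum hk π m n
  obtain ⟨A, hA, hA'⟩ := exists_numOnes_eq_ex hk π m
  obtain ⟨B, hB, hB'⟩ := exists_numOnes_eq_ex hk π n
  rw [← hA', ← hB', ← numOnes_blockSum φ]
  exact numOnes_le_ex (hφ A B hA hB)

theorem numAvoiders_mul_le {k : ℕ} (hk : 0 < k) (π : Equiv.Perm (Fin k)) (m n : ℕ) :
    numAvoiders (π.permMatrix (Fin 2)) m * numAvoiders (π.permMatrix (Fin 2)) n ≤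
      numAvoiders (π.permMatrix (Fin 2)) (m + n) := by
  classical
  obtain ⟨φ, hφ⟩ := exists_avoids_blockSum hk π m n
  rw [numAvoiders, numAvoiders, numAvoiders, ← Finset.card_product]
  refine Finset.card_le_card_of_injOn (fun X => blockSum φ X.1 X.2) ?_
    (blockSum_injective φ).injOn
  rintro ⟨A, B⟩ h
  simp only [Finset.coe_product, Set.mem_prod, Finset.coe_filter, Finset.mem_univ, true_and,
    Set.mem_ofPred_eq] at h ⊢
  exact ⟨isPermMatrix_blockSum φ h.1.1 h.2.1, hφ A B h.1.2 h.2.2⟩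

theorem one_le_numAvoiders_of_lt {n k : ℕ} (P : ZeroOneMatrix k) (h : n < k) :
    1 ≤ numAvoiders P n := by
  classical
  rw [numAvoiders, Nat.one_le_iff_ne_zero, ← Nat.pos_iff_ne_zero, Finset.card_pos]
  exact ⟨(1 : Equiv.Perm (Fin n)).permMatrix (Fin 2), by
    simpa using ⟨⟨1, by simp⟩, avoids_of_lt _ P h⟩⟩

/-- A 1 × 1 matrix is too small to contain the pattern, and block sums of 1 × 1 avoiders reach every
size. This makes logarithms of the counts nonnegative. -/
theorem one_le_numAvoiders {k : ℕ} (hk : 2 ≤ k) (π : Equiv.Perm (Fin k)) (n : ℕ) :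
    1 ≤ numAvoiders (π.permMatrix (Fin 2)) n := by
  induction n with
  | zero => exact one_le_numAvoiders_of_lt _ (by omega)
  | succ n ih =>
    exact (Nat.mul_le_mul ih (one_le_numAvoiders_of_lt (n := 1) _ (by omega))).trans
      (numAvoiders_mul_le (by omega) π n 1)

theorem ex_one_le {k : ℕ} (P : ZeroOneMatrix k) : ex 1 P ≤ 1 := by
  classical
  rw [ex, Finset.sup_le_iff]
  intro A _
  simp only [numOnes_eq_sum, Fin.sum_univ_one]
  split_ifs <;> simp

theorem one_le_ex_one {k : ℕ} (hk : 2 ≤ k) (P : ZeroOneMatrix k) : 1 ≤ ex 1 P := by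
  have := numOnes_le_ex (avoids_of_lt (1 : ZeroOneMatrix 1) P (by omega))
  simpa only [numOnes_eq_sum, Fin.sum_univ_one, Matrix.one_apply_eq, if_true] using this

theorem ex_eq_zero_of_le_one {k : ℕ} (hk : k ≤ 1) (P : ZeroOneMatrix k) (n : ℕ) :
    ex n P = 0 := by
  classical
  rw [ex, ← Nat.bot_eq_zero, Finset.sup_eq_bot_iff]
  intro A hA
  rw [Nat.bot_eq_zero, numOnes, Finset.card_eq_zero, Finset.filter_eq_empty_iff]
  rintro ⟨i, j⟩ - h
  exact (Finset.mem_filter.1 hA).2 (contains_of_eq_one hk h P)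

theorem numAvoiders_eq_zero_of_le_one {k : ℕ} (hk : k ≤ 1) (P : ZeroOneMatrix k) {n : ℕ}
    (hn : n ≠ 0) : numAvoiders P n = 0 := by
  classical
  rw [numAvoiders, Finset.card_eq_zero, Finset.filter_eq_empty_iff]
  rintro A - ⟨⟨σ, rfl⟩, h⟩
  exact h (contains_of_eq_one hk ((permMatrix_eq_one_iff σ ⟨0, Nat.pos_of_ne_zero hn⟩ _).2 rfl) P)

/-! ### Block contraction and the Marcus-Tardos linear bound -/

theorem finProdFinEquiv_lt_of_fst_lt {n s : ℕ} {i j : Fin n} (h : i < j) (x y : Fin s) :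
    finProdFinEquiv (i, x) < finProdFinEquiv (j, y) := by
  rw [Fin.lt_def, finProdFinEquiv_apply_val, finProdFinEquiv_apply_val]
  have h1 : s * (i.val + 1) ≤ s * j.val := Nat.mul_le_mul_left _ h
  have := x.2
  dsimp only
  rw [mul_add] at h1
  omega

theorem finProdFinEquiv_lt_of_snd_lt {n s : ℕ} (i : Fin n) {x y : Fin s} (h : x < y) :
    finProdFinEquiv (i, x) < finProdFinEquiv (i, y) := by
  rw [Fin.lt_def, finProdFinEquiv_apply_val, finProdFinEquiv_apply_val]
  simpa using h

/-- The `s × s` block of `A` in position `(i, j)`. -/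
def block {n s : ℕ} (A : ZeroOneMatrix (n * s)) (i j : Fin n) : ZeroOneMatrix s :=
  fun x y => A (finProdFinEquiv (i, x)) (finProdFinEquiv (j, y))

/-- The matrix recording which `s × s` blocks of `A` are nonzero. -/
noncomputable def contract {n s : ℕ} (A : ZeroOneMatrix (n * s)) : ZeroOneMatrix n :=
  fun i j => open Classical in if ∃ x y, block A i j x y = 1 then 1 else 0

theorem contract_eq_one_iff {n s : ℕ} {A : ZeroOneMatrix (n * s)} {i j : Fin n} :
    contract A i j = 1 ↔ ∃ x y, block A i j x y = 1 := by
  simp [contract]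

/-- Each row and column of a permutation pattern carries a single one, so the ones of a copy in the
contraction can be lifted independently into their blocks; order is preserved because the blocks lie
in distinct block rows and columns. -/
theorem avoids_contract {n s k : ℕ} {A : ZeroOneMatrix (n * s)} {π : Equiv.Perm (Fin k)}
    (h : Avoids A (π.permMatrix (Fin 2))) : Avoids (contract A) (π.permMatrix (Fin 2)) := by
  rw [Avoids, contains_permMatrix_iff] at *
  rintro ⟨r, c, hr, hc, hA⟩
  simp only [contract_eq_one_iff] at hA
  choose x y hxy using hA
  refine h ⟨fun i => finProdFinEquiv (r i, x i), fun j => finProdFinEquiv (c j, y (π.symm j)),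
    fun i j hij => finProdFinEquiv_lt_of_fst_lt (hr hij) _ _,
    fun i j hij => finProdFinEquiv_lt_of_fst_lt (hc hij) _ _, fun i => ?_⟩
  simpa only [Equiv.symm_apply_apply, block] using hxy i

theorem numOnes_eq_sum_block {n s : ℕ} (A : ZeroOneMatrix (n * s)) :
    numOnes A = ∑ i, ∑ j, numOnes (block A i j) := by
  simp only [numOnes_eq_sum]
  rw [← Equiv.sum_comp finProdFinEquiv, Fintype.sum_prod_type]
  refine Finset.sum_congr rfl fun i _ => ?_
  refine Eq.trans (Finset.sum_congr rfl fun x _ => ?_) Finset.sum_comm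
  rw [← Equiv.sum_comp finProdFinEquiv, Fintype.sum_prod_type]
  rfl

/-- The nonzero columns of `A`. -/
def columnSupport {s : ℕ} (A : ZeroOneMatrix s) : Finset (Fin s) :=
  Finset.univ.filter fun y => ∃ x, A x y = 1

theorem numOnes_le_mul_card {s : ℕ} (A : ZeroOneMatrix s) :
    numOnes A ≤ (columnSupport A.transpose).card * (columnSupport A).card := by
  rw [numOnes, ← Finset.card_product]
  refine Finset.card_le_card fun p hp => ?_
  simp only [Finset.mem_filter, Finset.mem_univ, true_and] at hp
  rw [Finset.mem_product]
  exact ⟨Finset.mem_filter.2 ⟨Finset.mem_univ _, _, hp⟩,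
    Finset.mem_filter.2 ⟨Finset.mem_univ _, _, hp⟩⟩

/-- Pigeonhole over the 2^s column supports: too many wide blocks in one block column would yield k
of them with a common support of at least k columns. Taking one row from each such block, with its
one in the column prescribed by π, gives a copy of the pattern. -/
theorem card_wide_blocks_le {n s k : ℕ} {A : ZeroOneMatrix (n * s)} {π : Equiv.Perm (Fin k)}
    (h : Avoids A (π.permMatrix (Fin 2))) (j : Fin n) :
    (Finset.univ.filter fun i => k ≤ (columnSupport (block A i j)).card).card ≤ 2 ^ s * k := by
  by_contra! hlt
  obtain ⟨U, -, hU⟩ := Finset.exists_lt_card_fiber_of_mul_lt_card_of_maps_to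
    (t := (Finset.univ : Finset (Finset (Fin s)))) (f := fun i => columnSupport (block A i j))
    (fun _ _ => Finset.mem_univ _) (n := k) (by simpa using hlt)
  obtain ⟨R, hR, hRk⟩ := Finset.exists_subset_card_eq hU.le
  have hmem : ∀ i ∈ R, k ≤ (columnSupport (block A i j)).card ∧
      columnSupport (block A i j) = U := fun i hi => by simpa using hR hi
  have hUk : k ≤ U.card := by
    obtain ⟨i, hi⟩ := Finset.card_pos.1 (Nat.zero_lt_of_lt hU)
    obtain ⟨h1, h2⟩ : k ≤ (columnSupport (block A i j)).card ∧
      columnSupport (block A i j) = U := by simpa using hi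
    exact h2 ▸ h1
  obtain ⟨C, hC, hCk⟩ := Finset.exists_subset_card_eq hUk
  have hone : ∀ i, ∃ x, block A (R.orderEmbOfFin hRk i) j x (C.orderEmbOfFin hCk (π i)) = 1 := by
    intro i
    have h1 := hC (Finset.orderEmbOfFin_mem C hCk (π i))
    rw [← (hmem _ (Finset.orderEmbOfFin_mem R hRk i)).2] at h1
    simpa [columnSupport] using h1
  choose x hx using hone
  refine h (contains_permMatrix_iff.2
    ⟨fun i => finProdFinEquiv (R.orderEmbOfFin hRk i, x i),
      fun i => finProdFinEquiv (j, C.orderEmbOfFin hCk i), fun i i' hi => ?_, fun i i' hi => ?_, hx⟩)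
  · exact finProdFinEquiv_lt_of_fst_lt ((R.orderEmbOfFin hRk).strictMono hi) _ _
  · exact finProdFinEquiv_lt_of_snd_lt _ ((C.orderEmbOfFin hCk).strictMono hi)

theorem avoids_transpose {n k : ℕ} {A : ZeroOneMatrix n} {π : Equiv.Perm (Fin k)}
    (h : Avoids A (π.permMatrix (Fin 2))) :
    Avoids A.transpose (π⁻¹.permMatrix (Fin 2)) := by
  rw [Avoids, contains_permMatrix_iff] at *
  rintro ⟨r, c, hr, hc, hA⟩
  exact h ⟨c, r, hc, hr, fun i => by simpa using hA (π i)⟩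

/-- A block that is neither wide nor tall has its ones inside a (k - 1) × (k - 1) subgrid, and an
empty block contributes nothing. -/
theorem numOnes_block_le {n s : ℕ} (A : ZeroOneMatrix (n * s)) (k : ℕ) (i j : Fin n) :
    numOnes (block A i j) ≤
      s ^ 2 * (if k ≤ (columnSupport (block A i j)).card then 1 else 0) +
      s ^ 2 * (if k ≤ (columnSupport (block A.transpose j i)).card then 1 else 0) +
      (k - 1) ^ 2 * (if contract A i j = 1 then 1 else 0) := by
  have hle := numOnes_le_mul_card (block A i j)
  have htr : block A.transpose j i = (block A i j).transpose := rfl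
  have h1 := Finset.card_le_univ (columnSupport (block A i j))
  have h2 := Finset.card_le_univ (columnSupport (block A i j).transpose)
  rw [Fintype.card_fin] at h1 h2
  have hs : numOnes (block A i j) ≤ s ^ 2 := hle.trans (by rw [pow_two]; gcongr)
  rw [htr]
  split_ifs with hw ht hc hc ht hc hc
  all_goals try omega
  · refine hle.trans ?_
    rw [mul_zero, zero_add, zero_add, mul_one, pow_two]
    gcongr <;> omega
  · have : numOnes (block A i j) = 0 := by
      rw [numOnes, Finset.card_eq_zero, Finset.filter_eq_empty_iff]
      rintro ⟨x, y⟩ - hxy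
      exact hc (contract_eq_one_iff.2 ⟨x, y, hxy⟩)
    omega

/-- The Marcus-Tardos recurrence. -/
theorem ex_mul_le {k : ℕ} (hk : 0 < k) (π : Equiv.Perm (Fin k)) (n s : ℕ) :
    ex (n * s) (π.permMatrix (Fin 2)) ≤
      2 * s ^ 2 * (2 ^ s * k) * n + (k - 1) ^ 2 * ex n (π.permMatrix (Fin 2)) := by
  obtain ⟨A, hA, hA'⟩ := exists_numOnes_eq_ex hk π (n * s)
  have hw : ∑ i, ∑ j, (if k ≤ (columnSupport (block A i j)).card then 1 else 0) ≤
      n * (2 ^ s * k) := by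
    rw [Finset.sum_comm]
    refine (Finset.sum_le_card_nsmul _ _ (2 ^ s * k) fun j _ => ?_).trans (by simp)
    rw [← Finset.card_filter]
    exact card_wide_blocks_le hA j
  have ht : ∑ i, ∑ j, (if k ≤ (columnSupport (block A.transpose j i)).card then 1 else 0) ≤
      n * (2 ^ s * k) := by
    refine (Finset.sum_le_card_nsmul _ _ (2 ^ s * k) fun j _ => ?_).trans (by simp)
    rw [← Finset.card_filter]
    exact card_wide_blocks_le (avoids_transpose hA) j
  have hc := numOnes_le_ex (avoids_contract hA)
  rw [numOnes_eq_sum] at hc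
  calc ex (n * s) (π.permMatrix (Fin 2)) = ∑ i, ∑ j, numOnes (block A i j) := by
        rw [← hA', numOnes_eq_sum_block]
    _ ≤ ∑ i, ∑ j, (s ^ 2 * (if k ≤ (columnSupport (block A i j)).card then 1 else 0) +
          s ^ 2 * (if k ≤ (columnSupport (block A.transpose j i)).card then 1 else 0) +
          (k - 1) ^ 2 * (if contract A i j = 1 then 1 else 0)) :=
        Finset.sum_le_sum fun i _ => Finset.sum_le_sum fun j _ => numOnes_block_le A k i j
    _ ≤ s ^ 2 * (n * (2 ^ s * k)) + s ^ 2 * (n * (2 ^ s * k)) +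
          (k - 1) ^ 2 * ex n (π.permMatrix (Fin 2)) := by
        simp only [Finset.sum_add_distrib, ← Finset.mul_sum]
        gcongr
    _ = _ := by ring

theorem exists_ex_pow_le {k : ℕ} (hk : 0 < k) (π : Equiv.Perm (Fin k)) :
    ∃ D : ℕ, ∀ m : ℕ, ex ((k ^ 2) ^ m) (π.permMatrix (Fin 2)) ≤ D * (k ^ 2) ^ m := by
  -- The constant is the coefficient of n in `ex_mul_le` at s = k². The induction closes because 1 +
  -- (k - 1)² ≤ k².
  refine ⟨2 * (k ^ 2) ^ 2 * (2 ^ (k ^ 2) * k), fun m => ?_⟩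
  induction m with
  | zero =>
    refine (ex_one_le _).trans ?_
    rw [pow_zero, mul_one]
    exact Nat.one_le_iff_ne_zero.2 (by positivity)
  | succ m ih =>
    set D := 2 * (k ^ 2) ^ 2 * (2 ^ (k ^ 2) * k) with hD
    obtain ⟨l, rfl⟩ := Nat.exists_eq_succ_of_ne_zero hk.ne'
    calc _ ≤ D * ((l + 1) ^ 2) ^ m + l ^ 2 * ex (((l + 1) ^ 2) ^ m) (π.permMatrix (Fin 2)) := by
          rw [pow_succ ((l + 1) ^ 2) m, hD]
          exact ex_mul_le hk π _ _
      _ ≤ D * ((l + 1) ^ 2) ^ m + l ^ 2 * (D * ((l + 1) ^ 2) ^ m) := by gcongr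
      _ = D * ((l + 1) ^ 2) ^ m * (1 + l ^ 2) := by ring
      _ ≤ D * ((l + 1) ^ 2) ^ m * (l + 1) ^ 2 := by gcongr; nlinarith
      _ = _ := by rw [Nat.succ_eq_add_one]; ring

/-! ### Counting avoiding matrices by doubling -/

/-- The number of `n × n` matrices avoiding `P`. -/
noncomputable def numAvoidingMatrices {k : ℕ} (P : ZeroOneMatrix k) (n : ℕ) : ℕ :=
  open Classical in (Finset.univ.filter fun A : ZeroOneMatrix n => Avoids A P).card

/-- Such a matrix is determined by its blocks at the ones of `B`, each one of the 2^4 - 1 = 15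
nonzero 2 × 2 matrices. -/
theorem card_contract_eq_le {n : ℕ} (B : ZeroOneMatrix n) :
    Fintype.card {A : ZeroOneMatrix (n * 2) // contract A = B} ≤ 15 ^ numOnes B := by
  classical
  let f : {A : ZeroOneMatrix (n * 2) // contract A = B} →
      {p : Fin n × Fin n // B p.1 p.2 = 1} → {M : ZeroOneMatrix 2 // M ≠ 0} := fun A p =>
    ⟨block A.1 p.1.1 p.1.2, fun h => by
      have hp := p.2
      rw [← congrFun (congrFun A.2 p.1.1) p.1.2, contract_eq_one_iff, h] at hp
      simp at hp⟩
  have hf : Function.Injective f := by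
    rintro ⟨A, hA⟩ ⟨A', hA'⟩ h
    refine Subtype.ext (Matrix.ext fun a b => ?_)
    obtain ⟨⟨i, x⟩, rfl⟩ := finProdFinEquiv.surjective a
    obtain ⟨⟨j, y⟩, rfl⟩ := finProdFinEquiv.surjective b
    change block A i j x y = block A' i j x y
    by_cases hB : B i j = 1
    · exact congrFun (congrFun (congrArg Subtype.val (congrFun h ⟨(i, j), hB⟩)) x) y
    · have h0 : ∀ M : ZeroOneMatrix (n * 2), contract M = B → block M i j x y = 0 := by
        intro M hM
        by_contra hne
        rw [← hM, contract_eq_one_iff] at hB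
        exact hB ⟨x, y, Fin.eq_one_of_ne_zero _ hne⟩
      rw [h0 A hA, h0 A' hA']
  refine (Fintype.card_le_of_injective f hf).trans_eq ?_
  rw [Fintype.card_fun, Fintype.card_subtype_compl, Fintype.card_subtype_eq, numOnes,
    Fintype.card_subtype]
  congr 1

/-- Klazar's inequality. -/
theorem numAvoidingMatrices_mul_two_le {k : ℕ} (π : Equiv.Perm (Fin k)) (n : ℕ) :
    numAvoidingMatrices (π.permMatrix (Fin 2)) (n * 2) ≤
      numAvoidingMatrices (π.permMatrix (Fin 2)) n * 15 ^ ex n (π.permMatrix (Fin 2)) := by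
  classical
  rw [numAvoidingMatrices, numAvoidingMatrices, mul_comm (Finset.card _)]
  refine Finset.card_le_mul_card_image_of_maps_to (f := contract) (fun A hA => ?_) _
    fun B hB => ?_
  · simp only [Finset.mem_filter, Finset.mem_univ, true_and] at hA ⊢
    exact avoids_contract hA
  · simp only [Finset.mem_filter, Finset.mem_univ, true_and] at hB
    calc _ ≤ (Finset.univ.filter fun A : ZeroOneMatrix (n * 2) => contract A = B).card :=
          Finset.card_le_card (Finset.filter_subset_filter _ (Finset.filter_subset _ _))
      _ = Fintype.card {A : ZeroOneMatrix (n * 2) // contract A = B} :=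
          (Fintype.card_subtype _).symm
      _ ≤ 15 ^ numOnes B := card_contract_eq_le B
      _ ≤ _ := Nat.pow_le_pow_right (by norm_num) (numOnes_le_ex hB)

/-! ### Counting permutations with a given contraction -/

/-- If nonempty, the set of solutions is a coset of the stabilizer of `g`, which is the product of
the symmetric groups on the fibres of `g`. -/
theorem card_perm_comp_eq_le {α ι : Type*} [Fintype α] [DecidableEq α] [Fintype ι]
    [DecidableEq ι] (g f : α → ι) :
    Fintype.card {σ : Equiv.Perm α // g ∘ σ = f} ≤
      ∏ i, (Fintype.card {a // g a = i}).factorial := by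
  rw [← DomMulAct.stabilizer_card]
  rcases isEmpty_or_nonempty {σ : Equiv.Perm α // g ∘ σ = f} with h | ⟨⟨σ₀, h₀⟩⟩
  · simp
  · refine Fintype.card_le_of_injective
      (fun σ => ⟨σ₀⁻¹.trans σ.1, ?_⟩) fun σ τ h => ?_
    · rw [Equiv.coe_trans, ← Function.comp_assoc, σ.2, ← h₀, Function.comp_assoc]
      ext a
      simp
    · refine Subtype.ext (Equiv.ext fun a => ?_)
      have := congrArg (fun ρ => ρ.1 (σ₀ a)) h
      simpa using this

/-- The function sending a row to the block column of its image has, for each of the t rows in block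
row i, as many values as row i of `B` has ones. Given this function, t! arrangements per block
column remain. -/
theorem card_perm_block_le {n t : ℕ} (B : ZeroOneMatrix n) :
    Fintype.card {σ : Equiv.Perm (Fin n × Fin t) // ∀ a, B a.1 (σ a).1 = 1} ≤
      (∏ i, Fintype.card {j // B i j = 1}) ^ t * t.factorial ^ n := by
  classical
  let F := Finset.univ.filter fun σ : Equiv.Perm (Fin n × Fin t) => ∀ a, B a.1 (σ a).1 = 1
  have hmaps : ∀ σ ∈ F, (fun a => (σ a).1) ∈ Fintype.piFinset
      fun a : Fin n × Fin t => Finset.univ.filter fun j => B a.1 j = 1 := by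
    intro σ hσ
    simpa [F] using hσ
  have hcard := Finset.card_le_mul_card_image_of_maps_to hmaps (t.factorial ^ n) fun f _ => ?_
  · rw [Fintype.card_subtype]
    refine hcard.trans_eq ?_
    rw [mul_comm, Fintype.card_piFinset, Fintype.prod_prod_type, ← Finset.prod_pow]
    simp [Fintype.card_subtype]
  · calc _ ≤ (Finset.univ.filter fun σ : Equiv.Perm (Fin n × Fin t) => Prod.fst ∘ σ = f).card :=
          Finset.card_le_card (Finset.filter_subset_filter _ (Finset.filter_subset _ _))
      _ = Fintype.card {σ : Equiv.Perm (Fin n × Fin t) // Prod.fst ∘ σ = f} :=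
          (Fintype.card_subtype _).symm
      _ ≤ ∏ i, (Fintype.card {a : Fin n × Fin t // a.1 = i}).factorial :=
          card_perm_comp_eq_le _ _
      _ = _ := by
        have h : ∀ i : Fin n, Fintype.card {a : Fin n × Fin t // a.1 = i} = t := fun i => by
          rw [Fintype.card_congr (β := Fin t)
            ⟨fun a => a.1.2, fun y => ⟨(i, y), rfl⟩, by rintro ⟨⟨_, y⟩, rfl⟩; rfl, fun _ => rfl⟩,
            Fintype.card_fin]
        simp [h]

/-- AM-GM applied to the numbers of ones in the rows, whose mean is at most c. -/
theorem prod_card_row_le {n : ℕ} (B : ZeroOneMatrix n) {c : ℝ} (hB : (numOnes B : ℝ) ≤ c * n) :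
    ((∏ i, Fintype.card {j // B i j = 1} : ℕ) : ℝ) ≤ c ^ n := by
  rcases Nat.eq_zero_or_pos n with rfl | hn
  · simp
  have hn' : (0 : ℝ) < n := by exact_mod_cast hn
  have amgm := Real.geom_mean_le_arith_mean Finset.univ (fun _ : Fin n => (1 : ℝ))
    (fun i => (Fintype.card {j // B i j = 1} : ℝ)) (by simp) (by simpa using hn) (by simp)
  have hsum : ∑ i, (Fintype.card {j // B i j = 1} : ℝ) = numOnes B := by
    rw [numOnes_eq_sum]
    push_cast
    refine Finset.sum_congr rfl fun i _ => ?_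
    simp [Fintype.card_subtype]
  simp only [Real.rpow_one, one_mul, Finset.sum_const, Finset.card_univ, Fintype.card_fin,
    nsmul_eq_mul, mul_one, hsum] at amgm
  have hle := amgm.trans ((div_le_iff₀ hn').2 hB)
  have hnn : (0 : ℝ) ≤ ∏ i, (Fintype.card {j // B i j = 1} : ℝ) :=
    Finset.prod_nonneg fun _ _ => Nat.cast_nonneg _
  push_cast
  calc _ = ((∏ i, (Fintype.card {j // B i j = 1} : ℝ)) ^ (n : ℝ)⁻¹) ^ n :=
        (Real.rpow_inv_natCast_pow hnn hn.ne').symm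
    _ ≤ c ^ n := by gcongr

/-- A permutation of `n * t` points whose matrix avoids `P` is determined by its contraction, the
block column of each row, and a bijection within each block column. -/
theorem numAvoiders_mul_le_numAvoidingMatrices {k : ℕ} (π : Equiv.Perm (Fin k)) (n t : ℕ) {c : ℝ}
    (hc : (ex n (π.permMatrix (Fin 2)) : ℝ) ≤ c * n) :
    (numAvoiders (π.permMatrix (Fin 2)) (n * t) : ℝ) ≤
      numAvoidingMatrices (π.permMatrix (Fin 2)) n * (c ^ (n * t) * t.factorial ^ n) := by
  classical
  let S := Finset.univ.filter fun A : ZeroOneMatrix (n * t) =>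
    IsPermMatrix A ∧ Avoids A (π.permMatrix (Fin 2))
  let T := Finset.univ.filter fun B : ZeroOneMatrix n => Avoids B (π.permMatrix (Fin 2))
  have hmaps : ∀ A ∈ S, contract A ∈ T := fun A hA => by
    simp only [S, T, Finset.mem_filter, Finset.mem_univ, true_and] at hA ⊢
    exact avoids_contract hA.2
  have hfib : ∀ B ∈ T, ((S.filter fun A => contract A = B).card : ℝ) ≤
      c ^ (n * t) * t.factorial ^ n := by
    intro B hB
    have hB' : Avoids B (π.permMatrix (Fin 2)) := by simpa [T] using hB
    have h1 : (S.filter fun A => contract A = B).card ≤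
        Fintype.card {σ : Equiv.Perm (Fin n × Fin t) // ∀ a, B a.1 (σ a).1 = 1} := by
      rw [Fintype.card_subtype]
      refine Finset.card_le_card_of_surjOn
        (fun σ => Equiv.Perm.permMatrix (Fin 2)
          ((finProdFinEquiv.symm.trans σ).trans finProdFinEquiv)) ?_
      intro A hA
      simp only [S, Finset.coe_filter, Finset.mem_filter, Finset.mem_univ, true_and,
        Set.mem_ofPred_eq] at hA
      obtain ⟨⟨⟨σ, rfl⟩, -⟩, hA⟩ := hA
      refine ⟨(finProdFinEquiv.trans σ).trans finProdFinEquiv.symm, ?_, ?_⟩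
      · simp only [Finset.coe_filter, Finset.mem_univ, true_and, Set.mem_ofPred_eq]
        intro a
        rw [← hA, contract_eq_one_iff]
        refine ⟨a.2, (finProdFinEquiv.symm (σ (finProdFinEquiv a))).2, ?_⟩
        rw [block, permMatrix_eq_one_iff]
        exact (finProdFinEquiv.apply_symm_apply _).symm
      · dsimp only
        congr 1
        ext1 a
        simp [-finProdFinEquiv_symm_apply]
    have h2 := prod_card_row_le B (c := c)
      (le_trans (by exact_mod_cast numOnes_le_ex hB') hc)
    calc ((S.filter fun A => contract A = B).card : ℝ)
        ≤ (((∏ i, Fintype.card {j // B i j = 1}) ^ t * t.factorial ^ n : ℕ) : ℝ) := by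
          exact_mod_cast h1.trans (card_perm_block_le B)
      _ ≤ (c ^ n) ^ t * t.factorial ^ n := by
          rw [Nat.cast_mul, Nat.cast_pow, Nat.cast_pow]
          gcongr
      _ = _ := by rw [pow_mul]
  have hS : (S.card : ℝ) = ∑ B ∈ T, ((S.filter fun A => contract A = B).card : ℝ) := by
    rw [Finset.card_eq_sum_card_fiberwise hmaps]
    push_cast
    rfl
  calc _ = (S.card : ℝ) := rfl
    _ ≤ T.card • (c ^ (n * t) * (t.factorial : ℝ) ^ n) := by
        rw [hS]
        exact Finset.sum_le_card_nsmul _ _ _ hfib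
    _ = _ := by
        rw [nsmul_eq_mul]
        rfl

theorem numAvoidingMatrices_one_le {k : ℕ} (P : ZeroOneMatrix k) :
    numAvoidingMatrices P 1 ≤ 2 := by
  classical
  refine (Finset.card_le_univ _).trans_eq ?_
  simp [Matrix]

/-- Iterating the doubling inequality from size 1 accumulates the exponent c (1 + 2 + ⋯ + 2^(m-1)).
-/
theorem numAvoidingMatrices_two_pow_le {k : ℕ} (π : Equiv.Perm (Fin k)) {c : ℝ}
    (hc : ∀ n : ℕ, (ex n (π.permMatrix (Fin 2)) : ℝ) ≤ c * n) (m : ℕ) :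
    (numAvoidingMatrices (π.permMatrix (Fin 2)) (2 ^ m) : ℝ) ≤
      2 * (15 : ℝ) ^ (c * (2 ^ m - 1)) := by
  induction m with
  | zero => simpa using numAvoidingMatrices_one_le _
  | succ m ih =>
    have h := numAvoidingMatrices_mul_two_le π (2 ^ m)
    have hm := hc (2 ^ m)
    push_cast at hm
    calc (numAvoidingMatrices (π.permMatrix (Fin 2)) (2 ^ (m + 1)) : ℝ)
        ≤ numAvoidingMatrices (π.permMatrix (Fin 2)) (2 ^ m) *
          (15 : ℝ) ^ ex (2 ^ m) (π.permMatrix (Fin 2)) := by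
          rw [pow_succ]
          exact_mod_cast h
      _ ≤ 2 * (15 : ℝ) ^ (c * (2 ^ m - 1)) * (15 : ℝ) ^ (c * 2 ^ m) := by
          rw [← Real.rpow_natCast]
          gcongr
          norm_num
      _ = _ := by
          rw [mul_assoc, ← Real.rpow_add (by norm_num)]
          congr 2
          ring

/-! ### Numerical estimates for F -/

/-- An explicit Stirling bound, with 0.3905 slightly above 1/e and tuned to t = 48. The inductive
step needs 0.3905 (1 + 1/t)^t ≥ 1, which follows from t log(1 + 1/t) ≥ 2t/(2t + 1) ≥ 96/97. -/
theorem factorial_le_pow {t : ℕ} (ht : 48 ≤ t) : (t.factorial : ℝ) ≤ (0.3905 * t) ^ t := by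
  induction t, ht using Nat.le_induction with
  | base =>
    have : Nat.factorial 48 * 10000 ^ 48 ≤ (3905 * 48) ^ 48 := by decide +kernel
    have h : ((Nat.factorial 48 : ℕ) : ℝ) * 10000 ^ 48 ≤ (3905 * 48) ^ 48 := by exact_mod_cast this
    rw [show (0.3905 * (48 : ℕ) : ℝ) = 3905 * 48 / 10000 by norm_num, div_pow,
      le_div_iff₀ (by positivity)]
    exact h
  | succ t ht ih =>
    have htR : (48 : ℝ) ≤ t := by exact_mod_cast ht
    have ht0 : (0 : ℝ) < t := by linarith
    have hlog := Real.le_log_one_add_of_nonneg (inv_nonneg.2 ht0.le)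
    have hexp : Real.exp (96 / 97) ≤ (1 + (t : ℝ)⁻¹) ^ t := by
      rw [← Real.rpow_natCast, Real.rpow_def_of_pos (by positivity), Real.exp_le_exp]
      refine le_trans ?_ (mul_le_mul_of_nonneg_right hlog ht0.le)
      rw [show 2 * (t : ℝ)⁻¹ / ((t : ℝ)⁻¹ + 2) * t = 2 * t / (1 + 2 * t) by field_simp,
        div_le_div_iff₀ (by norm_num) (by positivity)]
      linarith
    have hbase : (1 : ℝ) ≤ 0.3905 * Real.exp (96 / 97) := by
      have h1 : Real.exp 1 = Real.exp (96 / 97) * Real.exp (1 / 97) := by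
        rw [← Real.exp_add]
        norm_num
      have h2 : Real.exp (1 / 97) ≤ 97 / 96 := by
        have := Real.exp_bound_div_one_sub_of_interval' (x := 1 / 97) (by norm_num) (by norm_num)
        refine this.le.trans ?_
        norm_num
      have h3 := Real.exp_one_gt_d9
      have h4 := Real.exp_pos (96 / 97)
      nlinarith
    calc ((t + 1).factorial : ℝ) = (t + 1) * t.factorial := by
          rw [Nat.factorial_succ]
          push_cast
          rfl
      _ ≤ (t + 1) * (0.3905 * t) ^ t := by gcongr
      _ ≤ (t + 1) * (0.3905 * t) ^ t * (0.3905 * (1 + (t : ℝ)⁻¹) ^ t) :=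
          le_mul_of_one_le_right (by positivity) (hbase.trans (by gcongr))
      _ = (0.3905 * (t + 1)) * (0.3905 * (t * (1 + (t : ℝ)⁻¹))) ^ t := by
          rw [mul_pow, mul_pow, mul_pow]
          ring
      _ = (0.3905 * ((t + 1 : ℕ) : ℝ)) ^ (t + 1) := by
          rw [mul_add (t : ℝ), mul_one, mul_inv_cancel₀ ht0.ne', pow_succ]
          push_cast
          ring

theorem log_fifteen_le : Real.log 15 ≤ 2.70808 := by
  have h1 : Real.log 15 = 4 * Real.log 2 - Real.log (1 + 1 / 15) := by
    rw [show (1 + 1 / 15 : ℝ) = 2 ^ 4 / 15 by norm_num, Real.log_div (by norm_num) (by norm_num),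
      Real.log_pow]
    push_cast
    ring
  have h2 := Real.le_log_one_add_of_nonneg (x := 1 / 15) (by norm_num)
  have h3 := Real.log_two_lt_d9
  norm_num at h1 h2 h3 ⊢
  linarith

theorem le_log_fifteen : 2.7058 ≤ Real.log 15 := by
  have h1 : Real.log 15 = 4 * Real.log 2 - Real.log (16 / 15) := by
    rw [show (16 / 15 : ℝ) = 2 ^ 4 / 15 by norm_num, Real.log_div (by norm_num) (by norm_num),
      Real.log_pow]
    push_cast
    ring
  have h2 := Real.log_le_sub_one_of_pos (x := 16 / 15) (by norm_num)
  have h3 := Real.log_two_gt_d9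
  norm_num at h1 h2 h3 ⊢
  linarith

theorem bddBelow_range_F {c : ℝ} (hc : 0 ≤ c) :
    BddBelow (Set.range fun t : ℕ+ => ((Nat.factorial (t : ℕ) : ℝ) ^ (1 / ((t : ℕ) : ℝ)) *
      (15 : ℝ) ^ (c / ((t : ℕ) : ℝ))) / c) := by
  refine ⟨0, ?_⟩
  rintro _ ⟨t, rfl⟩
  positivity

theorem F_lt {c : ℝ} (hc : 17 ≤ c) : F c < 2.88 := by
  have hL1 := log_fifteen_le
  have hL2 := le_log_fifteen
  -- With x = c log 15 / t the quantity to bound is about e^x / x up to constants, minimal at x = 1;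
  -- the floor 48 makes `factorial_le_pow` available.
  set t : ℕ := max 48 ⌈c * Real.log 15⌉₊ with ht
  have ht48 : 48 ≤ t := le_max_left _ _
  have htR : (48 : ℝ) ≤ t := by exact_mod_cast ht48
  have ht0 : (0 : ℝ) < t := by linarith
  have hc0 : (0 : ℝ) < c := by linarith
  have hle : c * Real.log 15 ≤ t := (Nat.le_ceil _).trans (by exact_mod_cast le_max_right _ _)
  set x := c * Real.log 15 / t with hx
  have hx1 : x ≤ 1 := (div_le_one ht0).2 hle
  -- The worst case is c = 17, t = 48, where x ≥ 17 · 2.7058 / 48 > 0.9582; above 48, rounding up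
  -- costs less than 1/t.
  have hx0 : 0.9582 ≤ x := by
    rw [hx, le_div_iff₀ ht0]
    rcases le_total 48 ⌈c * Real.log 15⌉₊ with h | h
    · have hceil := Nat.ceil_lt_add_one (a := c * Real.log 15) (by positivity)
      rw [← max_eq_right h, ← ht] at hceil
      linarith
    · rw [ht, max_eq_left h]
      push_cast
      nlinarith
  have hfac : (t.factorial : ℝ) ^ (1 / (t : ℝ)) ≤ 0.3905 * t := by
    rw [one_div]
    exact (Real.rpow_inv_le_iff_of_pos (by positivity) (by positivity) ht0).2
      (by rw [Real.rpow_natCast]; exact factorial_le_pow ht48)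
  have h15 : (15 : ℝ) ^ (c / (t : ℝ)) = Real.exp x := by
    rw [Real.rpow_def_of_pos (by norm_num), hx]
    congr 1
    ring
  have hexp : Real.exp x * (2 - x) ≤ Real.exp 1 := by
    have h := Real.add_one_le_exp (1 - x)
    calc Real.exp x * (2 - x) ≤ Real.exp x * Real.exp (1 - x) := by gcongr; linarith
      _ = Real.exp 1 := by rw [← Real.exp_add]; congr 1; ring
  -- The constant must satisfy 0.3905 · 7.375 < 2.88. It suffices that e log 15 ≤ 7.375 x (2 - x),
  -- and x (2 - x) is increasing up to x = 1, so x = 0.9582 is the extreme case.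
  have hexp' : Real.exp x * Real.log 15 ≤ 7.375 * x := by
    have h1 := Real.exp_one_lt_d9
    have h2 := Real.exp_pos x
    have h3 : Real.exp x * (2 - x) * Real.log 15 ≤ 2.7182818286 * 2.70808 := by
      gcongr
      exact hexp.trans h1.le
    have h4 : (2.7182818286 * 2.70808 : ℝ) ≤ 7.375 * x * (2 - x) := by
      nlinarith [mul_nonneg (sub_nonneg.2 hx0) (by linarith : 0 ≤ 2 - 0.9582 - x)]
    have h5 : 0 < 2 - x := by linarith
    refine le_of_mul_le_mul_right ?_ h5
    linarith
  calc F c ≤ ((t.factorial : ℝ) ^ (1 / (t : ℝ)) * (15 : ℝ) ^ (c / (t : ℝ))) / c :=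
        ciInf_le (bddBelow_range_F hc0.le) (⟨t, by omega⟩ : ℕ+)
    _ ≤ 0.3905 * t * Real.exp x / c := by
        rw [h15]
        gcongr
    _ ≤ 0.3905 * 7.375 := by
        have hct : c * Real.log 15 = x * t := by rw [hx]; field_simp
        rw [div_le_iff₀ hc0]
        have h6 : t * (Real.exp x * Real.log 15) ≤ t * (7.375 * x) := by gcongr
        have h7 : t * Real.exp x * Real.log 15 ≤ 7.375 * c * Real.log 15 := by nlinarith
        have := le_of_mul_le_mul_right h7 (by linarith)
        linarith
    _ < 2.88 := by norm_num

/-! ### Existence of the limits and the upper bound -/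

/-- Fekete's lemma for a superadditive sequence with linear growth along the powers of `b`. -/
theorem exists_tendsto_of_superadditive {u : ℕ → ℝ} (hadd : ∀ m n, u m + u n ≤ u (m + n))
    (hnn : ∀ n, 0 ≤ u n) {b : ℕ} (hb : 2 ≤ b) {D : ℝ} (hD : ∀ m, u (b ^ m) ≤ D * (b : ℝ) ^ m) :
    ∃ l : ℝ, Tendsto (fun n : ℕ => u n / n) atTop (𝓝 l) ∧ ∀ n, u n ≤ l * n := by
  have hmono : ∀ m n, m ≤ n → u m ≤ u n := by
    intro m n hmn
    obtain ⟨d, rfl⟩ := Nat.exists_eq_add_of_le hmn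
    linarith [hadd m d, hnn d]
  have h0 : u 0 = 0 := by linarith [hadd 0 0, hnn 0]
  have hD0 : 0 ≤ D := by simpa using (hnn _).trans (hD 0)
  -- By monotonicity, comparison with the next power of b costs only a factor b.
  have hlin : ∀ n, u n ≤ D * b * n := by
    intro n
    rcases eq_or_ne n 0 with rfl | hn
    · simp [h0]
    have h1 : (b ^ Nat.log b n : ℝ) ≤ n := by exact_mod_cast Nat.pow_log_le_self b hn
    calc u n ≤ u (b ^ (Nat.log b n + 1)) := hmono _ _ (Nat.lt_pow_succ_log_self (by omega) n).le
      _ ≤ D * (b : ℝ) ^ (Nat.log b n + 1) := hD _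
      _ = D * b * (b : ℝ) ^ Nat.log b n := by ring
      _ ≤ D * b * n := by gcongr
  have hsub : Subadditive fun n => -u n := fun m n => by linarith [hadd m n]
  have hbdd : BddBelow (Set.range fun n : ℕ => -u n / n) := by
    refine ⟨-(D * b), ?_⟩
    rintro _ ⟨n, rfl⟩
    rcases eq_or_ne n 0 with rfl | hn
    · simp only [Nat.cast_zero, div_zero, Left.neg_nonpos_iff]
      positivity
    · have hn' : (0 : ℝ) < n := by positivity
      dsimp only
      rw [le_div_iff₀ hn']
      linarith [hlin n]
  refine ⟨-hsub.lim, ?_, fun n => ?_⟩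
  · simpa [neg_div] using (hsub.tendsto_lim hbdd).neg
  · rcases eq_or_ne n 0 with rfl | hn
    · simp [h0]
    · have := hsub.lim_le_div hbdd hn
      rw [le_div_iff₀ (by positivity)] at this
      linarith

/-- The Füredi-Hajnal limit exists. -/
theorem exists_tendsto_ex {k : ℕ} (hk : 2 ≤ k) (π : Equiv.Perm (Fin k)) :
    ∃ c : ℝ, Tendsto (fun n : ℕ => (ex n (π.permMatrix (Fin 2)) : ℝ) / n) atTop (𝓝 c) ∧
      ∀ n : ℕ, (ex n (π.permMatrix (Fin 2)) : ℝ) ≤ c * n := by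
  obtain ⟨D, hD⟩ := exists_ex_pow_le (by omega : 0 < k) π
  refine exists_tendsto_of_superadditive (u := fun n => (ex n (π.permMatrix (Fin 2)) : ℝ))
    (b := k ^ 2) (D := D) (fun m n => ?_) (fun n => Nat.cast_nonneg _) (by nlinarith) (fun m => ?_)
  · exact_mod_cast ex_add_le (by omega) π m n
  · exact_mod_cast hD m

/-- The two counts combined at n = 2^m. Since ex(1, P) ≥ 1 forces c ≥ 1, all logarithms split. -/
theorem log_numAvoiders_le {k : ℕ} (hk : 2 ≤ k) (π : Equiv.Perm (Fin k)) {c : ℝ}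
    (hc : ∀ n : ℕ, (ex n (π.permMatrix (Fin 2)) : ℝ) ≤ c * n) (m t : ℕ) :
    Real.log (numAvoiders (π.permMatrix (Fin 2)) (2 ^ m * t)) ≤
      Real.log 2 + 2 ^ m * (c * Real.log 15 + t * Real.log c + Real.log t.factorial) := by
  have hc1 : 1 ≤ c := by
    have h1 : (1 : ℝ) ≤ ex 1 (π.permMatrix (Fin 2)) := by exact_mod_cast one_le_ex_one hk _
    simpa using h1.trans (hc 1)
  have hpos : (0 : ℝ) < numAvoiders (π.permMatrix (Fin 2)) (2 ^ m * t) := by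
    exact_mod_cast one_le_numAvoiders hk π _
  have hfac : (0 : ℝ) < t.factorial := by exact_mod_cast t.factorial_pos
  have h := numAvoiders_mul_le_numAvoidingMatrices π (2 ^ m) t (hc _)
  have h2 : (numAvoiders (π.permMatrix (Fin 2)) (2 ^ m * t) : ℝ) ≤
      2 * (15 : ℝ) ^ (c * 2 ^ m) * (c ^ (2 ^ m * t) * (t.factorial : ℝ) ^ 2 ^ m) := by
    refine h.trans (mul_le_mul_of_nonneg_right ?_ (by positivity))
    refine (numAvoidingMatrices_two_pow_le π hc m).trans ?_
    gcongr
    · norm_num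
    · linarith
  refine (Real.log_le_log hpos h2).trans_eq ?_
  rw [Real.log_mul (by positivity) (by positivity), Real.log_mul (by norm_num) (by positivity),
    Real.log_mul (by positivity) (by positivity), Real.log_rpow (by norm_num), Real.log_pow,
    Real.log_pow]
  push_cast
  ring

/-- The Stanley-Wilf limit exists and is bounded in terms of the Füredi-Hajnal limit. -/
theorem exists_tendsto_numAvoiders {k : ℕ} (hk : 2 ≤ k) (π : Equiv.Perm (Fin k)) {c : ℝ}
    (hc : ∀ n : ℕ, (ex n (π.permMatrix (Fin 2)) : ℝ) ≤ c * n) :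
    ∃ s : ℝ, Tendsto (fun n : ℕ => (numAvoiders (π.permMatrix (Fin 2)) n : ℝ) ^ (1 / (n : ℝ)))
      atTop (𝓝 s) ∧ ∀ t : ℕ, 0 < t →
        s ≤ (t.factorial : ℝ) ^ (1 / (t : ℝ)) * (15 : ℝ) ^ (c / (t : ℝ)) * c := by
  have hc1 : 1 ≤ c := by
    have h1 : (1 : ℝ) ≤ ex 1 (π.permMatrix (Fin 2)) := by exact_mod_cast one_le_ex_one hk _
    simpa using h1.trans (hc 1)
  have hpos : ∀ n, (1 : ℝ) ≤ numAvoiders (π.permMatrix (Fin 2)) n := fun n => by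
    exact_mod_cast one_le_numAvoiders hk π n
  have hsuper : ∀ m n, Real.log (numAvoiders (π.permMatrix (Fin 2)) m) +
      Real.log (numAvoiders (π.permMatrix (Fin 2)) n) ≤
      Real.log (numAvoiders (π.permMatrix (Fin 2)) (m + n)) := by
    intro m n
    have h1 := zero_lt_one.trans_le (hpos m)
    have h2 := zero_lt_one.trans_le (hpos n)
    rw [← Real.log_mul h1.ne' h2.ne']
    exact Real.log_le_log (by positivity) (by exact_mod_cast numAvoiders_mul_le (by omega) π m n)
  have hgrowth : ∀ m, Real.log (numAvoiders (π.permMatrix (Fin 2)) (2 ^ m)) ≤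
      (Real.log 2 + (c * Real.log 15 + Real.log c)) * ((2 : ℕ) : ℝ) ^ m := by
    intro m
    -- The case t = 1 already gives exponential growth along powers of 2.
    have h := log_numAvoiders_le hk π hc m 1
    have h2 : (1 : ℝ) ≤ 2 ^ m := one_le_pow₀ (by norm_num)
    have h3 := Real.log_nonneg (x := 2) (by norm_num)
    simp only [mul_one, Nat.cast_one, one_mul, Nat.factorial_one, Real.log_one, add_zero] at h
    push_cast
    nlinarith
  obtain ⟨l, hl, -⟩ := exists_tendsto_of_superadditive
    (u := fun n => Real.log (numAvoiders (π.permMatrix (Fin 2)) n))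
    hsuper (fun n => Real.log_nonneg (hpos n)) le_rfl hgrowth
  refine ⟨Real.exp l, ?_, fun t ht => ?_⟩
  · refine ((Real.continuous_exp.tendsto l).comp hl).congr fun n => ?_
    rw [Real.rpow_def_of_pos (zero_lt_one.trans_le (hpos n)), mul_one_div]
    rfl
  · have ht0 : (0 : ℝ) < t := by exact_mod_cast ht
    have hfac : (0 : ℝ) < t.factorial := by exact_mod_cast t.factorial_pos
    have hpow : Tendsto (fun m : ℕ => (2 : ℝ) ^ m) atTop atTop :=
      tendsto_pow_atTop_atTop_of_one_lt (by norm_num)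
    have hnat : Tendsto (fun m : ℕ => 2 ^ m * t) atTop atTop :=
      (tendsto_pow_atTop_atTop_of_one_lt (by norm_num)).atTop_mul_const' ht
    -- The limit is known to exist, so it may be evaluated along the sizes 2^m t, where the term log
    -- 2 disappears.
    have hsub := hl.comp hnat
    have hlim : Tendsto (fun m : ℕ => Real.log 2 / t / 2 ^ m +
        (c * Real.log 15 + t * Real.log c + Real.log t.factorial) / t) atTop
        (𝓝 (0 + (c * Real.log 15 + t * Real.log c + Real.log t.factorial) / t)) :=
      (tendsto_const_nhds.div_atTop hpow).add tendsto_const_nhds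
    have hle := le_of_tendsto_of_tendsto' hsub hlim fun m => by
      have h := log_numAvoiders_le hk π hc m t
      simp only [Function.comp_apply]
      push_cast
      rw [div_le_iff₀ (by positivity)]
      refine h.trans_eq ?_
      field_simp
    calc Real.exp l ≤ Real.exp (0 + (c * Real.log 15 + t * Real.log c +
          Real.log t.factorial) / t) := Real.exp_le_exp.2 hle
      _ = Real.exp (Real.log t.factorial * (1 / t) + Real.log 15 * (c / t) + Real.log c) := by
        congr 1
        field_simp
        ring
      _ = _ := by
        rw [Real.exp_add, Real.exp_add, Real.exp_log (by linarith),
          Real.rpow_def_of_pos hfac, Real.rpow_def_of_pos (by norm_num)]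

end ForbiddenPattern

theorem corollary2 {k : ℕ} (P : ForbiddenPattern.ZeroOneMatrix k)
    (hP : ForbiddenPattern.IsPermMatrix P) :
    Tendsto (fun n : ℕ => (ForbiddenPattern.numAvoiders P n : ℝ) ^ (1 / (n : ℝ))) atTop
        (𝓝 (ForbiddenPattern.stanleyWilfLimit P)) ∧
      Tendsto (fun n : ℕ => (ForbiddenPattern.ex n P : ℝ) / (n : ℝ)) atTop
        (𝓝 (ForbiddenPattern.furediHajnalLimit P)) ∧
      (17 ≤ ForbiddenPattern.furediHajnalLimit P →
        ForbiddenPattern.stanleyWilfLimit P ≤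
            ForbiddenPattern.F (ForbiddenPattern.furediHajnalLimit P) *
              ForbiddenPattern.furediHajnalLimit P ^ 2 ∧
          ForbiddenPattern.F (ForbiddenPattern.furediHajnalLimit P) < 2.88) := by
  obtain ⟨π, rfl⟩ := hP
  -- For k ≤ 1 any one already contains the pattern, so both limits are 0 and c ≥ 17 fails.
  rcases Nat.lt_or_ge k 2 with hk | hk
  · have hs : Tendsto (fun n : ℕ =>
        (ForbiddenPattern.numAvoiders (π.permMatrix (Fin 2)) n : ℝ) ^ (1 / (n : ℝ))) atTop
        (𝓝 0) := by
      refine tendsto_const_nhds.congr' ?_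
      filter_upwards [eventually_ne_atTop 0] with n hn
      rw [ForbiddenPattern.numAvoiders_eq_zero_of_le_one (by omega) _ hn, Nat.cast_zero,
        Real.zero_rpow (by positivity)]
    have hc : Tendsto (fun n : ℕ =>
        (ForbiddenPattern.ex n (π.permMatrix (Fin 2)) : ℝ) / (n : ℝ)) atTop (𝓝 0) := by
      refine tendsto_const_nhds.congr fun n => ?_
      rw [ForbiddenPattern.ex_eq_zero_of_le_one (by omega), Nat.cast_zero, zero_div]
    have hc' : ForbiddenPattern.furediHajnalLimit (π.permMatrix (Fin 2)) = 0 := hc.limUnder_eq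
    refine ⟨tendsto_nhds_limUnder ⟨_, hs⟩, tendsto_nhds_limUnder ⟨_, hc⟩, fun h => ?_⟩
    rw [hc'] at h
    norm_num at h
  · obtain ⟨c, hc, hcle⟩ := ForbiddenPattern.exists_tendsto_ex hk π
    obtain ⟨s, hs, hsle⟩ := ForbiddenPattern.exists_tendsto_numAvoiders hk π hcle
    have hc' : ForbiddenPattern.furediHajnalLimit (π.permMatrix (Fin 2)) = c := hc.limUnder_eq
    have hs' : ForbiddenPattern.stanleyWilfLimit (π.permMatrix (Fin 2)) = s := hs.limUnder_eq
    rw [hc', hs']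
    refine ⟨hs, hc, fun h => ⟨?_, ForbiddenPattern.F_lt h⟩⟩
    have hc0 : 0 < c := by linarith
    -- Dividing by c² isolates the infimum, so it is enough to bound s / c² by the term for each t.
    rw [← div_le_iff₀ (by positivity)]
    refine le_ciInf fun t => ?_
    have ht := hsle t t.pos
    rw [div_le_div_iff₀ (by positivity) hc0]
    calc s * c ≤ _ * c := mul_le_mul_of_nonneg_right ht hc0.le
      _ = _ := by ring
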